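/- Let $L^2(0,\infty)$ be the complex Lebesgue space, and let $\mathcal{H}_\infty$ be the bounded Hardy operator on it, $(\mathcal{H}_\infty f)(x)=\frac1x\int_0^x f(t)\,dt$ for $0<x<\infty$. Let $L^p(i\mathbb{R})$ be taken with respect to Lebesgue measure $dy$ at the points $iy$, and let $\mathcal{Q}:L^2(0,\infty)\to L^2(i\mathbb{R})$ be the unitary Mellin transform $$(\mathcal{Q}f)(iy)=\frac{1}{\sqrt{2\pi}}\int_0^\infty f(u)\,u^{iy-\frac12}\,du .$$ For $g\in L^\infty(i\mathbb{R})$ let $M_g$ be the operator of multiplication by $g$ on $L^2(i\mathbb{R})$. Let $A$ be a bounded linear operator on $L^2(0,\infty)$. Then $A\mathcal{H}_\infty=\mathcal{H}_\infty A$ if and only if there exists $g\in L^\infty(i\mathbb{R})$ such that $$(Af)(t)=\frac{1}{2\pi}\int_{-\infty}^{\infty}t^{-iy-\frac12}\,g(iy)\Big(\int_0^\infty f(u)\,u^{iy-\frac12}\,du\Big)dy\qquad\text{for all } f\in L^2(0,\infty),$$ where the integrals are understood in the $L^2$ sense: the inner one is the limit in $L^2(\mathbb{R},dy)$ of $\int_{1/R}^{R}f(u)u^{iy-\frac12}\,du$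 as $R\to\infty$, and the outer one is the limit in $L^2(0,\infty)$ of the integrals over $[-R,R]$ as $R\to\infty$. Moreover, for each $g\in L^\infty(i\mathbb{R})$ this formula holds for all $f$ if and only if $A=\mathcal{Q}^{-1}M_g\mathcal{Q}$; consequently, $A$ commutes with $\mathcal{H}_\infty$ if and only if $A=\mathcal{Q}^{-1}M_g\mathcal{Q}$ for some $g\in L^\infty(i\mathbb{R})$. -/

import Mathlib

open MeasureTheory Set
open scoped ENNReal Topology

namespace HardyMellin

noncomputable section

/-- The complex Hilbert space `L²(0, ∞)`. -/
abbrev L2Pos : Type := Lp ℂ 2 (volume.restrict (Ioi (0 : ℝ)))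

/-- The space `L²(iℝ)`, a function on `iℝ` being written as a function of the real parameter `β`
of the point `iβ`. -/
abbrev L2Line : Type := Lp ℂ 2 (volume : Measure ℝ)

/-- The average `(1 / x) ∫₀ˣ f(t) dt`. -/
def hardyFun (f : ℝ → ℂ) (x : ℝ) : ℂ := (1 / (x : ℂ)) * ∫ t in Ioc 0 x, f t

theorem hardyFun_stronglyMeasurable {f : ℝ → ℂ} (hf : StronglyMeasurable f) :
    StronglyMeasurable (hardyFun f) := by
  have h1 : StronglyMeasurable (fun x : ℝ => ∫ t in Ioc 0 x, f t) := by
    have h2 : StronglyMeasurable (fun p : ℝ × ℝ =>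
        ({q : ℝ × ℝ | 0 < q.2 ∧ q.2 ≤ q.1}).indicator (fun q => f q.2) p) := by
      refine (hf.comp_measurable measurable_snd).indicator ?_
      exact (measurableSet_lt measurable_const measurable_snd).inter
        (measurableSet_le measurable_snd measurable_fst)
    have h3 := h2.integral_prod_right' (ν := (volume : Measure ℝ))
    convert h3 using 2 with x
    rw [← integral_indicator measurableSet_Ioc]
    rfl
  have h2 : Measurable (fun x : ℝ => 1 / (x : ℂ)) := by fun_prop
  exact h2.stronglyMeasurable.mul h1

theorem lintegral_rpow_Ioc_zero {x : ℝ} (hx : 0 < x) :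
    ∫⁻ t in Ioc 0 x, ENNReal.ofReal (t ^ (-(1 / 2) : ℝ)) =
      ENNReal.ofReal (2 * x ^ (1 / 2 : ℝ)) := by
  have hi : IntegrableOn (fun t : ℝ => t ^ (-(1 / 2) : ℝ)) (Ioc 0 x) := by
    have := intervalIntegral.intervalIntegrable_rpow' (a := 0) (b := x) (r := -(1 / 2))
      (by norm_num)
    rwa [intervalIntegrable_iff_integrableOn_Ioc_of_le hx.le] at this
  rw [← ofReal_integral_eq_lintegral_ofReal hi]
  · rw [← intervalIntegral.integral_of_le hx.le, integral_rpow (Or.inl (by norm_num))]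
    congr 1
    norm_num
    ring
  · filter_upwards [ae_restrict_mem measurableSet_Ioc] with t ht
    exact Real.rpow_nonneg ht.1.le _

theorem lintegral_rpow_Ici {t : ℝ} (ht : 0 < t) :
    ∫⁻ x in Ici t, ENNReal.ofReal (x ^ (-(3 / 2) : ℝ)) =
      ENNReal.ofReal (2 * t ^ (-(1 / 2) : ℝ)) := by
  rw [setLIntegral_congr Ioi_ae_eq_Ici.symm, ← ofReal_integral_eq_lintegral_ofReal
    (integrableOn_Ioi_rpow_of_lt (by norm_num) ht)]
  · rw [integral_Ioi_rpow_of_lt (by norm_num) ht]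
    congr 1
    norm_num
    ring
  · filter_upwards [ae_restrict_mem measurableSet_Ioi] with x hx
    exact Real.rpow_nonneg (ht.trans hx).le _

theorem hardyFun_enorm_sq_le {f : ℝ → ℂ} (hf : StronglyMeasurable f) {x : ℝ} (hx : 0 < x) :
    ‖hardyFun f x‖ₑ ^ 2 ≤ 2 * (ENNReal.ofReal (x ^ (-(3 / 2) : ℝ)) *
      ∫⁻ t in Ioc 0 x, ENNReal.ofReal (t ^ (1 / 2 : ℝ)) * ‖f t‖ₑ ^ 2) := by
  have hm : Measurable (fun t => ‖f t‖ₑ) := hf.measurable.enorm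
  have h1 : ‖∫ t in Ioc 0 x, f t‖ₑ ≤
      (∫⁻ t in Ioc 0 x, ENNReal.ofReal (t ^ (1 / 2 : ℝ)) * ‖f t‖ₑ ^ 2) ^ (1 / 2 : ℝ) *
      (∫⁻ t in Ioc 0 x, ENNReal.ofReal (t ^ (-(1 / 2) : ℝ))) ^ (1 / 2 : ℝ) := by
    refine (enorm_integral_le_lintegral_enorm _).trans ?_
    have h2 := ENNReal.lintegral_mul_le_Lp_mul_Lq (volume.restrict (Ioc 0 x))
      (p := 2) (q := 2) Real.HolderConjugate.two_two
      (f := fun t => ENNReal.ofReal (t ^ (1 / 4 : ℝ)) * ‖f t‖ₑ)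
      (g := fun t => ENNReal.ofReal (t ^ (-(1 / 4) : ℝ)))
      (by fun_prop) (by fun_prop)
    refine le_trans (le_of_eq ?_) (h2.trans (le_of_eq ?_))
    · refine setLIntegral_congr_fun measurableSet_Ioc fun t ht => ?_
      simp only [Pi.mul_apply]
      rw [mul_right_comm, ← ENNReal.ofReal_mul (Real.rpow_nonneg ht.1.le _),
        ← Real.rpow_add ht.1]
      norm_num
    · congr 2
      · refine setLIntegral_congr_fun measurableSet_Ioc fun t ht => ?_
        rw [ENNReal.mul_rpow_of_nonneg _ _ (by norm_num : (0 : ℝ) ≤ 2),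
          ENNReal.ofReal_rpow_of_nonneg (Real.rpow_nonneg ht.1.le _) (by norm_num),
          ← Real.rpow_mul ht.1.le]
        norm_num
      · refine setLIntegral_congr_fun measurableSet_Ioc fun t ht => ?_
        rw [ENNReal.ofReal_rpow_of_nonneg (Real.rpow_nonneg ht.1.le _) (by norm_num),
          ← Real.rpow_mul ht.1.le]
        norm_num
  rw [lintegral_rpow_Ioc_zero hx] at h1
  set J := ∫⁻ t in Ioc 0 x, ENNReal.ofReal (t ^ (1 / 2 : ℝ)) * ‖f t‖ₑ ^ 2
  have h3 : ‖∫ t in Ioc 0 x, f t‖ₑ ^ 2 ≤ J * ENNReal.ofReal (2 * x ^ (1 / 2 : ℝ)) := by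
    refine (pow_le_pow_left₀ zero_le h1 2).trans (le_of_eq ?_)
    rw [mul_pow, ← ENNReal.rpow_mul_natCast, ← ENNReal.rpow_mul_natCast]
    norm_num
  have h4 : ‖(1 / (x : ℂ))‖ₑ ^ 2 = ENNReal.ofReal (x ^ (-2 : ℝ)) := by
    rw [← ofReal_norm, ← ENNReal.ofReal_pow (norm_nonneg _)]
    congr 1
    rw [norm_div, norm_one, Complex.norm_real, Real.norm_of_nonneg hx.le,
      Real.rpow_neg hx.le]
    simp
  unfold hardyFun
  rw [enorm_mul, mul_pow, h4]
  refine (mul_le_mul_right h3 _).trans (le_of_eq ?_)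
  have h5 : ENNReal.ofReal (x ^ (-2 : ℝ)) * ENNReal.ofReal (2 * x ^ (1 / 2 : ℝ)) =
      2 * ENNReal.ofReal (x ^ (-(3 / 2) : ℝ)) := by
    rw [← ENNReal.ofReal_mul (Real.rpow_nonneg hx.le _), mul_left_comm, ← Real.rpow_add hx,
      ENNReal.ofReal_mul (by norm_num)]
    norm_num
  rw [mul_left_comm, h5]
  ring

/-- Hardy's inequality. -/
theorem lintegral_hardyFun_sq_le {f : ℝ → ℂ} (hf : StronglyMeasurable f) :
    ∫⁻ x in Ioi 0, ‖hardyFun f x‖ₑ ^ 2 ≤ 4 * ∫⁻ x in Ioi 0, ‖f x‖ₑ ^ 2 := by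
  have hm : Measurable (fun t => ‖f t‖ₑ) := hf.measurable.enorm
  set S : Set (ℝ × ℝ) := {q | 0 < q.2 ∧ q.2 ≤ q.1} with hS
  have hSm : MeasurableSet S :=
    (measurableSet_lt measurable_const measurable_snd).inter
      (measurableSet_le measurable_snd measurable_fst)
  set k : ℝ × ℝ → ℝ≥0∞ := S.indicator (fun q => ENNReal.ofReal (q.1 ^ (-(3 / 2) : ℝ)) *
      (ENNReal.ofReal (q.2 ^ (1 / 2 : ℝ)) * ‖f q.2‖ₑ ^ 2)) with hk
  have hkm : Measurable k := by
    refine Measurable.indicator ?_ hSm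
    have : Measurable fun q : ℝ × ℝ => ‖f q.2‖ₑ := hm.comp measurable_snd
    fun_prop
  calc ∫⁻ x in Ioi 0, ‖hardyFun f x‖ₑ ^ 2
      ≤ ∫⁻ x in Ioi 0, 2 * ∫⁻ t in Ioi 0, k (x, t) := by
        refine setLIntegral_mono' measurableSet_Ioi fun x hx => ?_
        refine (hardyFun_enorm_sq_le hf hx).trans (le_of_eq ?_)
        congr 1
        rw [← lintegral_const_mul _ (by fun_prop), ← lintegral_indicator measurableSet_Ioc,
          ← lintegral_indicator measurableSet_Ioi]
        congr 1 with t
        by_cases ht : 0 < t <;> by_cases htx : t ≤ x <;> simp [k, S, indicator, ht, htx]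
    _ = 2 * ∫⁻ t in Ioi 0, ∫⁻ x in Ioi 0, k (x, t) := by
        rw [lintegral_const_mul _ (hkm.lintegral_prod_right'), lintegral_lintegral_swap]
        exact hkm.aemeasurable
    _ = 2 * ∫⁻ t in Ioi 0, 2 * ‖f t‖ₑ ^ 2 := by
        congr 1
        refine setLIntegral_congr_fun measurableSet_Ioi fun t ht => ?_
        have ht' : 0 < t := ht
        have : ∫⁻ x in Ioi 0, k (x, t) = ∫⁻ x in Ici t, ENNReal.ofReal (x ^ (-(3 / 2) : ℝ)) *
            (ENNReal.ofReal (t ^ (1 / 2 : ℝ)) * ‖f t‖ₑ ^ 2) := by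
          rw [← lintegral_indicator measurableSet_Ioi, ← lintegral_indicator measurableSet_Ici]
          congr 1 with x
          by_cases htx : t ≤ x
          · have : 0 < x := ht'.trans_le htx
            simp [k, S, indicator, ht', htx, this]
          · simp [k, S, indicator, htx]
        simp only [this]
        rw [lintegral_mul_const _ (by fun_prop), lintegral_rpow_Ici ht', ← mul_assoc,
          ← ENNReal.ofReal_mul (by positivity), mul_assoc, ← Real.rpow_add ht']
        norm_num
    _ = 4 * ∫⁻ x in Ioi 0, ‖f x‖ₑ ^ 2 := by
        rw [lintegral_const_mul _ (by fun_prop), ← mul_assoc]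
        norm_num

theorem eLpNorm_two_eq {α : Type*} [MeasurableSpace α] (μ : Measure α) (f : α → ℂ) :
    eLpNorm f 2 μ = (∫⁻ x, ‖f x‖ₑ ^ 2 ∂μ) ^ (1 / 2 : ℝ) := by
  rw [eLpNorm_eq_lintegral_rpow_enorm_toReal (by norm_num) (by norm_num)]
  simp

theorem eLpNorm_hardyFun_le {f : ℝ → ℂ} (hf : StronglyMeasurable f) :
    eLpNorm (hardyFun f) 2 (volume.restrict (Ioi 0)) ≤
      2 * eLpNorm f 2 (volume.restrict (Ioi 0)) := by
  rw [eLpNorm_two_eq, eLpNorm_two_eq]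
  refine (ENNReal.rpow_le_rpow (lintegral_hardyFun_sq_le hf) (by norm_num)).trans (le_of_eq ?_)
  rw [ENNReal.mul_rpow_of_nonneg _ _ (by norm_num)]
  congr 1
  rw [show (4 : ℝ≥0∞) = 2 ^ (2 : ℝ) by norm_num, ← ENNReal.rpow_mul]
  norm_num

theorem hardyFun_memLp (f : L2Pos) : MemLp (hardyFun f) 2 (volume.restrict (Ioi 0)) :=
  ⟨(hardyFun_stronglyMeasurable (Lp.stronglyMeasurable f)).aestronglyMeasurable,
    (eLpNorm_hardyFun_le (Lp.stronglyMeasurable f)).trans_lt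
      (ENNReal.mul_lt_top (by norm_num) (Lp.eLpNorm_lt_top f))⟩

theorem L2Pos.integrableOn_Ioc (f : L2Pos) (x : ℝ) : IntegrableOn f (Ioc 0 x) := by
  have h : MemLp f 2 (volume.restrict (Ioc 0 x)) :=
    (Lp.memLp f).mono_measure (Measure.restrict_mono Ioc_subset_Ioi_self le_rfl)
  exact h.integrable (by norm_num)

theorem setIntegral_Ioc_congr {f g : ℝ → ℂ} (h : f =ᵐ[volume.restrict (Ioi 0)] g) (x : ℝ) :
    ∫ t in Ioc 0 x, f t = ∫ t in Ioc 0 x, g t :=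
  integral_congr_ae (ae_mono (Measure.restrict_mono Ioc_subset_Ioi_self le_rfl) h)

/-- The Hardy operator `H_∞` on `L²(0, ∞)`, `(H_∞ f)(x) = (1 / x) ∫₀ˣ f(t) dt`. -/
def hardyInfty : L2Pos →L[ℂ] L2Pos :=
  LinearMap.mkContinuous
    { toFun := fun f => (hardyFun_memLp f).toLp (hardyFun f)
      map_add' := fun f g => by
        rw [← MemLp.toLp_add]
        refine MemLp.toLp_congr _ _ (Filter.Eventually.of_forall fun x => ?_)
        simp only [hardyFun, Pi.add_apply]
        rw [setIntegral_Ioc_congr (Lp.coeFn_add f g), ← mul_add]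
        congr 1
        exact integral_add (L2Pos.integrableOn_Ioc f x) (L2Pos.integrableOn_Ioc g x)
      map_smul' := fun c f => by
        rw [RingHom.id_apply, ← MemLp.toLp_const_smul]
        refine MemLp.toLp_congr _ _ (Filter.Eventually.of_forall fun x => ?_)
        simp only [hardyFun, Pi.smul_apply]
        rw [setIntegral_Ioc_congr (Lp.coeFn_smul c f), ← mul_smul_comm]
        congr 1
        exact integral_smul c _ }
    2 (fun f => by
      rw [LinearMap.coe_mk, AddHom.coe_mk, Lp.norm_toLp, Lp.norm_def]
      have h := ENNReal.toReal_mono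
        (ENNReal.mul_lt_top (by norm_num) (Lp.eLpNorm_lt_top f)).ne
        (eLpNorm_hardyFun_le (Lp.stronglyMeasurable f))
      simpa using h)

/-- The substitution `t = exp (2πx)`: `x ↦ √(2π) e^{πx} f(e^{2πx})`. -/
def logPull (f : ℝ → ℂ) (x : ℝ) : ℂ :=
  ((√(2 * Real.pi) * Real.exp (Real.pi * x) : ℝ) : ℂ) * f (Real.exp (2 * Real.pi * x))

/-- The inverse substitution `x = log t / (2π)`. -/
def logPush (h : ℝ → ℂ) (t : ℝ) : ℂ :=
  ((√(2 * Real.pi) * √t : ℝ) : ℂ)⁻¹ * h (Real.log t / (2 * Real.pi))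

theorem image_exp_univ : (fun x : ℝ => Real.exp (2 * Real.pi * x)) '' univ = Ioi 0 := by
  have hpi := Real.pi_pos
  ext t
  simp only [image_univ, mem_range, mem_Ioi]
  constructor
  · rintro ⟨x, rfl⟩
    exact Real.exp_pos _
  · intro ht
    refine ⟨Real.log t / (2 * Real.pi), ?_⟩
    rw [mul_div_cancel₀ _ (by positivity), Real.exp_log ht]

theorem hasDerivWithinAt_exp_two_pi : ∀ x ∈ (univ : Set ℝ),
    HasDerivWithinAt (fun x : ℝ => Real.exp (2 * Real.pi * x))
      (2 * Real.pi * Real.exp (2 * Real.pi * x)) univ x := by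
  intro x _
  have := ((hasDerivAt_id x).const_mul (2 * Real.pi)).exp
  simp only [id, mul_one] at this
  rw [mul_comm (Real.exp _)] at this
  exact this.hasDerivWithinAt

theorem injOn_exp_two_pi : InjOn (fun x : ℝ => Real.exp (2 * Real.pi * x)) univ := by
  intro x _ y _ hxy
  have hpi := Real.pi_pos
  exact mul_left_cancel₀ (by positivity) (Real.exp_injective hxy)

theorem lintegral_Ioi_eq_exp (F : ℝ → ℝ≥0∞) :
    ∫⁻ t in Ioi 0, F t = ∫⁻ x : ℝ, ENNReal.ofReal (2 * Real.pi * Real.exp (2 * Real.pi * x)) *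
      F (Real.exp (2 * Real.pi * x)) := by
  have hpi := Real.pi_pos
  rw [← image_exp_univ, lintegral_image_eq_lintegral_abs_deriv_mul MeasurableSet.univ
    hasDerivWithinAt_exp_two_pi injOn_exp_two_pi, Measure.restrict_univ]
  congr 1 with x
  rw [abs_of_pos (by positivity)]

theorem eLpNorm_logPull (f : ℝ → ℂ) :
    eLpNorm (logPull f) 2 volume = eLpNorm f 2 (volume.restrict (Ioi 0)) := by
  have hpi := Real.pi_pos
  rw [eLpNorm_two_eq, eLpNorm_two_eq, lintegral_Ioi_eq_exp]
  congr 2 with x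
  rw [logPull, enorm_mul, mul_pow, ← ofReal_norm, Complex.norm_real,
    Real.norm_of_nonneg (by positivity), ← ENNReal.ofReal_pow (by positivity), mul_pow,
    Real.sq_sqrt (by positivity), ← Real.exp_nat_mul]
  congr 4
  push_cast
  ring

theorem exp_quasiMeasurePreserving :
    Measure.QuasiMeasurePreserving (fun x : ℝ => Real.exp (2 * Real.pi * x)) volume
      (volume.restrict (Ioi 0)) := by
  have hpi := Real.pi_pos
  have hm : Measurable (fun x : ℝ => Real.exp (2 * Real.pi * x)) := by fun_prop
  refine ⟨hm, Measure.AbsolutelyContinuous.mk fun s hs h0 => ?_⟩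
  rw [Measure.map_apply hm hs]
  have h1 := lintegral_Ioi_eq_exp (s.indicator 1)
  rw [lintegral_indicator_one hs, h0, eq_comm, lintegral_eq_zero_iff
    (by
      have : Measurable (s.indicator (1 : ℝ → ℝ≥0∞)) := measurable_one.indicator hs
      fun_prop)] at h1
  rw [measure_eq_zero_iff_ae_notMem]
  filter_upwards [h1] with x hx hxs
  have hxs' : Real.exp (2 * Real.pi * x) ∈ s := hxs
  simp only [hxs', indicator_of_mem, Pi.one_apply, mul_one, Pi.zero_apply,
    ENNReal.ofReal_eq_zero] at hx
  exact absurd hx (not_le.mpr (by positivity))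

theorem logPull_congr {f g : ℝ → ℂ} (h : f =ᵐ[volume.restrict (Ioi 0)] g) :
    logPull f =ᵐ[volume] logPull g := by
  filter_upwards [exp_quasiMeasurePreserving.ae_eq h] with x hx
  simp only [Function.comp_apply] at hx
  simp only [logPull, hx]

theorem logPull_memLp (f : L2Pos) : MemLp (logPull f) 2 volume := by
  refine ⟨?_, by rw [eLpNorm_logPull]; exact Lp.eLpNorm_lt_top f⟩
  have h1 : Measurable (f : ℝ → ℂ) := (Lp.stronglyMeasurable f).measurable
  have h2 : Measurable (logPull f) := by
    unfold logPull
    fun_prop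
  exact h2.aestronglyMeasurable

theorem logPull_logPush (h : ℝ → ℂ) : logPull (logPush h) = h := by
  have hpi := Real.pi_pos
  ext x
  have h1 : √(Real.exp (2 * Real.pi * x)) = Real.exp (Real.pi * x) := by
    rw [← Real.exp_half]
    congr 1
    ring
  rw [logPull, logPush, h1, Real.log_exp, mul_div_cancel_left₀ _ (by positivity),
    mul_inv_cancel_left₀]
  exact_mod_cast (by positivity : √(2 * Real.pi) * Real.exp (Real.pi * x) ≠ 0)

theorem logPush_memLp (h : L2Line) : MemLp (logPush h) 2 (volume.restrict (Ioi 0)) := by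
  refine ⟨?_, by rw [← eLpNorm_logPull, logPull_logPush]; exact Lp.eLpNorm_lt_top h⟩
  have h1 : Measurable (h : ℝ → ℂ) := (Lp.stronglyMeasurable h).measurable
  have h2 : Measurable (logPush h) := by
    unfold logPush
    fun_prop
  exact h2.aestronglyMeasurable

/-- `logPull` as a linear isometry from `L²(0, ∞)` to `L²(ℝ)`. -/
def logPullIsometry : L2Pos →ₗᵢ[ℂ] L2Line where
  toFun f := (logPull_memLp f).toLp (logPull f)
  map_add' f g := by
    rw [← MemLp.toLp_add]
    refine MemLp.toLp_congr _ _ ((logPull_congr (Lp.coeFn_add f g)).trans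
      (Filter.Eventually.of_forall fun x => ?_))
    simp only [logPull, Pi.add_apply, mul_add]
  map_smul' c f := by
    rw [RingHom.id_apply, ← MemLp.toLp_const_smul]
    refine MemLp.toLp_congr _ _ ((logPull_congr (Lp.coeFn_smul c f)).trans
      (Filter.Eventually.of_forall fun x => ?_))
    simp only [logPull, Pi.smul_apply, mul_smul_comm]
  norm_map' f := by
    rw [LinearMap.coe_mk, AddHom.coe_mk, Lp.norm_toLp, eLpNorm_logPull, Lp.norm_def]

theorem logPullIsometry_surjective : Function.Surjective logPullIsometry := by
  intro h
  refine ⟨(logPush_memLp h).toLp _, ?_⟩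
  refine Lp.ext ((MemLp.coeFn_toLp (logPull_memLp _)).trans
    ((logPull_congr (MemLp.coeFn_toLp _)).trans ?_))
  rw [logPull_logPush]

/-- `logPull` as a unitary map from `L²(0, ∞)` onto `L²(ℝ)`. -/
def logPullEquiv : L2Pos ≃ₗᵢ[ℂ] L2Line :=
  LinearIsometryEquiv.ofSurjective logPullIsometry logPullIsometry_surjective

/-- The unitary Mellin transform `Q : L²(0, ∞) → L²(iℝ)`,
`(Q f)(iβ) = (2π)^{-1/2} ∫₀^∞ f(t) t^{iβ - 1/2} dt`. Mathlib's inverse Fourier transform has the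
kernel `e^{2πiβx}`, and `t = e^{2πx}` turns `∫ e^{2πiβx} √(2π) e^{πx} f(e^{2πx}) dx` into the
integral above; see `mellinQ_ae_eq`. -/
def mellinQ : L2Pos ≃ₗᵢ[ℂ] L2Line :=
  logPullEquiv.trans (Lp.fourierTransformₗᵢ ℝ ℂ).symm

open FourierTransform SchwartzMap in
theorem fourierInv_L2_ae_eq (h : L2Line) (hi : Integrable h volume) :
    ((Lp.fourierTransformₗᵢ ℝ ℂ).symm h : ℝ → ℂ) =ᵐ[volume] 𝓕⁻ (h : ℝ → ℂ) := by
  have hc : Continuous (𝓕⁻ (h : ℝ → ℂ)) :=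
    VectorFourier.fourierIntegral_continuous (μ := volume) (L := -innerₗ ℝ)
      (e := Real.fourierChar) Real.continuous_fourierChar (by fun_prop) hi
  refine ae_eq_of_integral_contDiff_smul_eq ((Lp.memLp _).locallyIntegrable (by norm_num))
    hc.locallyIntegrable fun φ hφ hsupp => ?_
  have hsupp' : HasCompactSupport (fun x => (φ x : ℂ)) :=
    hsupp.comp_left (g := fun r : ℝ => (r : ℂ)) (by simp)
  let ψ : 𝓢(ℝ, ℂ) := hsupp'.toSchwartzMap (Complex.ofRealCLM.contDiff.comp hφ)
  have h1 := congrArg (fun T => T ψ) (Lp.fourierInv_toTemperedDistribution_eq h)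
  simp only [TemperedDistribution.fourierInv_apply, Lp.toTemperedDistribution_apply] at h1
  have h2 := VectorFourier.integral_fourierIntegral_smul_eq_flip (μ := volume) (ν := volume)
    (L := -innerₗ ℝ) (e := Real.fourierChar) (f := (ψ : ℝ → ℂ)) (g := (h : ℝ → ℂ))
    Real.continuous_fourierChar (by fun_prop) ψ.integrable hi
  have h3 : (-innerₗ ℝ).flip = -innerₗ ℝ := by
    ext
    simp
  rw [h3] at h2
  have h4 : ∫ x, φ x • ((Lp.fourierTransformₗᵢ ℝ ℂ).symm h) x = ∫ x, ψ x • (𝓕⁻ h : L2Line) x :=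
    integral_congr_ae (Filter.Eventually.of_forall fun x => Complex.real_smul)
  have h5 : ∫ x, φ x • 𝓕⁻ (h : ℝ → ℂ) x = ∫ x, ψ x • 𝓕⁻ (h : ℝ → ℂ) x :=
    integral_congr_ae (Filter.Eventually.of_forall fun x => Complex.real_smul)
  rw [h4, h5, ← h1, SchwartzMap.fourierInv_coe]
  exact h2

theorem integral_Ioi_eq_exp (F : ℝ → ℂ) :
    ∫ t in Ioi 0, F t = ∫ x : ℝ, |2 * Real.pi * Real.exp (2 * Real.pi * x)| •
      F (Real.exp (2 * Real.pi * x)) := by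
  rw [← image_exp_univ, integral_image_eq_integral_abs_deriv_smul MeasurableSet.univ
      hasDerivWithinAt_exp_two_pi injOn_exp_two_pi, Measure.restrict_univ]

theorem integrableOn_Ioi_iff_exp (F : ℝ → ℂ) :
    IntegrableOn F (Ioi 0) ↔ Integrable fun x : ℝ =>
      |2 * Real.pi * Real.exp (2 * Real.pi * x)| • F (Real.exp (2 * Real.pi * x)) := by
  rw [← image_exp_univ, integrableOn_image_iff_integrableOn_abs_deriv_smul MeasurableSet.univ
      hasDerivWithinAt_exp_two_pi injOn_exp_two_pi, integrableOn_univ]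

/-- On the functions for which the Mellin integral converges absolutely, `mellinQ` is given by
it. -/
theorem mellinQ_ae_eq (f : L2Pos)
    (hf : IntegrableOn (fun t : ℝ => f t * ((t : ℂ) ^ (-(1 / 2) : ℂ))) (Ioi 0)) :
    (mellinQ f : ℝ → ℂ) =ᵐ[volume] fun β : ℝ =>
      (1 / (√(2 * Real.pi) : ℂ)) *
        ∫ t in Ioi (0 : ℝ), f t * (t : ℂ) ^ (Complex.I * (β : ℂ) - 1 / 2) := by
  have hpi := Real.pi_pos
  have hs0 : (√(2 * Real.pi) : ℂ) ≠ 0 := by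
    exact_mod_cast (by positivity : √(2 * Real.pi) ≠ 0)
  have hsq : (√(2 * Real.pi) : ℂ) * (√(2 * Real.pi) : ℂ) = 2 * Real.pi := by
    exact_mod_cast Real.mul_self_sqrt (by positivity : (0 : ℝ) ≤ 2 * Real.pi)
  have hpow : ∀ (x : ℝ) (s : ℂ), ((Real.exp (2 * Real.pi * x) : ℝ) : ℂ) ^ s =
      Complex.exp (2 * Real.pi * x * s) := by
    intro x s
    rw [Complex.cpow_def_of_ne_zero (by exact_mod_cast (Real.exp_pos _).ne'),
      ← Complex.ofReal_log (Real.exp_pos _).le, Real.log_exp]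
    push_cast
    rfl
  have hker : ∀ (x : ℝ) (s : ℂ), |2 * Real.pi * Real.exp (2 * Real.pi * x)| •
      (f (Real.exp (2 * Real.pi * x)) * ((Real.exp (2 * Real.pi * x) : ℝ) : ℂ) ^ (s - 1 / 2)) =
      (√(2 * Real.pi) : ℂ) * (Complex.exp (2 * Real.pi * x * s) * logPull f x) := by
    intro x s
    have he : Complex.exp (2 * Real.pi * x) * Complex.exp (2 * Real.pi * x * (s - 1 / 2)) =
        Complex.exp (2 * Real.pi * x * s) * Complex.exp (Real.pi * x) := by
      rw [← Complex.exp_add, ← Complex.exp_add]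
      congr 1
      ring
    rw [abs_of_pos (by positivity), hpow, logPull, Complex.real_smul]
    push_cast
    linear_combination (2 * Real.pi * f (Real.exp (2 * Real.pi * x))) * he -
      Complex.exp (2 * Real.pi * x * s) * Complex.exp (Real.pi * x) *
      f (Real.exp (2 * Real.pi * x)) * hsq
  have hint : Integrable (logPull f) volume := by
    rw [integrableOn_Ioi_iff_exp] at hf
    refine (hf.const_mul (√(2 * Real.pi) : ℂ)⁻¹).congr (Filter.Eventually.of_forall fun x => ?_)
    have := hker x 0
    rw [zero_sub, mul_zero, Complex.exp_zero, one_mul] at this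
    simp only [this]
    rw [inv_mul_cancel_left₀ hs0]
  have hcoe : (logPullEquiv f : ℝ → ℂ) =ᵐ[volume] logPull f :=
    MemLp.coeFn_toLp (logPull_memLp f)
  refine (fourierInv_L2_ae_eq (logPullEquiv f) (hint.congr hcoe.symm)).trans
    (Filter.Eventually.of_forall fun β => ?_)
  simp only
  rw [integral_Ioi_eq_exp]
  simp only [hker]
  rw [integral_const_mul, one_div, inv_mul_cancel_left₀ hs0, Real.fourierInv_eq']
  refine integral_congr_ae ?_
  filter_upwards [hcoe] with x hx
  rw [hx, smul_eq_mul]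
  congr 2
  simp only [RCLike.inner_apply, conj_trivial]
  push_cast
  ring

/-- The operator `M_g` of multiplication by `g ∈ L^∞(iℝ)` on `L²(iℝ)`. -/
def mulOp (g : Lp ℂ ∞ (volume : Measure ℝ)) : L2Line →L[ℂ] L2Line :=
  (ContinuousLinearMap.mul ℂ ℂ).holderL volume ∞ 2 2 g

/-- The operator `Q⁻¹ M_g Q` on `L²(0, ∞)`. -/
def mellinMultiplier (g : Lp ℂ ∞ (volume : Measure ℝ)) : L2Pos →L[ℂ] L2Pos :=
  (mellinQ.symm : L2Line →L[ℂ] L2Pos) ∘L mulOp g ∘L (mellinQ : L2Pos →L[ℂ] L2Line)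

/-- The truncated inner integral `∫_{1/R}^R f(u) u^{iy - 1/2} du`. -/
def innerTrunc (f : ℝ → ℂ) (R y : ℝ) : ℂ :=
  ∫ u in Icc R⁻¹ R, f u * (u : ℂ) ^ (Complex.I * (y : ℂ) - 1 / 2)

/-- The truncated outer integral `(1 / 2π) ∫_{-R}^R t^{-iy - 1/2} G(iy) dy`. -/
def outerTrunc (G : ℝ → ℂ) (R t : ℝ) : ℂ :=
  (1 / (2 * (Real.pi : ℂ))) *
    ∫ y in Icc (-R) R, (t : ℂ) ^ (-(Complex.I * (y : ℂ)) - 1 / 2) * G y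

/-- `h ∈ L²(0, ∞)` is the double integral
`h(t) = (1 / 2π) ∫_{-∞}^∞ t^{-iy - 1/2} g(iy) (∫₀^∞ f(u) u^{iy - 1/2} du) dy`.
For general `f ∈ L²(0, ∞)` neither integral converges absolutely; as usual for the Mellin and
Fourier transforms on `L²`, both are limits in the mean of the truncated integrals. -/
def IsMellinDoubleIntegral (g : Lp ℂ ∞ (volume : Measure ℝ)) (f h : L2Pos) : Prop :=
  ∃ F : L2Line,
    Filter.Tendsto (fun R : ℝ => eLpNorm (fun y => innerTrunc f R y - F y) 2 volume)
      Filter.atTop (𝓝 0) ∧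
    Filter.Tendsto (fun R : ℝ => eLpNorm (fun t => outerTrunc (fun y => g y * F y) R t - h t) 2
      (volume.restrict (Ioi 0))) Filter.atTop (𝓝 0)

end

end HardyMellin

open HardyMellin

/-!
On the line `Re s = 1/2`, Fubini gives `mellin (H f) s = mellin f s / (1 - s)`: the Mellin transform
turns the Hardy operator into multiplication by the bounded injective function `y ↦ (1/2 - i y)⁻¹`.
By Fuglede's theorem, the bounded continuous functions whose multiplication operators commute with
a given operator `T` form a star algebra; if it contains an injective function it separates points,
and then integrals against its elements determine an integrable function. They cannot distinguish
`T f * conj h` from `f * conj (T† h)`, so these agree almost everywhere, and a nowhere vanishing `h`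
exhibits `T` as a multiplication operator. Finally, the truncated inner and outer integrals are the
Mellin transform and its inverse applied to truncated functions, so that their limits in the mean
are given by continuity of both transforms.
-/

namespace HardyMellin

open scoped BoundedContinuousFunction ComplexConjugate InnerProductSpace

noncomputable section

section Multiplication

variable {E : Type*} [MeasurableSpace E] {μ : Measure E} {p : ℝ≥0∞} [Fact (1 ≤ p)]

/-- The operator of multiplication by `g ∈ L^∞` on `Lᵖ`; for `p = 2` on the line it is `mulOp`. -/
def mulLp (p : ℝ≥0∞) [Fact (1 ≤ p)] (g : Lp ℂ ∞ μ) : Lp ℂ p μ →L[ℂ] Lp ℂ p μ :=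
  (ContinuousLinearMap.mul ℂ ℂ).holderL μ ∞ p p g

theorem mulLp_ae_eq (g : Lp ℂ ∞ μ) (f : Lp ℂ p μ) :
    mulLp p g f =ᵐ[μ] fun x => g x * f x :=
  ContinuousLinearMap.coeFn_holder _ g f

theorem commute_mulLp (g g' : Lp ℂ ∞ μ) : Commute (mulLp p g) (mulLp p g') := by
  refine ContinuousLinearMap.ext fun f => Lp.ext ?_
  filter_upwards [mulLp_ae_eq g (mulLp p g' f), mulLp_ae_eq g' (mulLp p g f), mulLp_ae_eq g f,
    mulLp_ae_eq g' f] with x h₁ h₂ h₃ h₄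
  simp only [ContinuousLinearMap.mul_def, ContinuousLinearMap.comp_apply, h₁, h₂, h₃, h₄,
    mul_left_comm]

section BoundedContinuous

variable [TopologicalSpace E] [BorelSpace E]

/-- The multiplication operator attached to a bounded continuous function. -/
def boundedMul (p : ℝ≥0∞) [Fact (1 ≤ p)] (μ : Measure E) (g : E →ᵇ ℂ) :
    Lp ℂ p μ →L[ℂ] Lp ℂ p μ :=
  mulLp p (g.memLp_top.toLp g)

theorem boundedMul_ae_eq (g : E →ᵇ ℂ) (f : Lp ℂ p μ) :
    boundedMul p μ g f =ᵐ[μ] fun x => g x * f x := by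
  filter_upwards [mulLp_ae_eq (g.memLp_top.toLp g) f, (g.memLp_top (μ := μ)).coeFn_toLp]
    with x h₁ h₂
  rw [boundedMul, h₁, h₂]

theorem eq_boundedMul_apply {g : E →ᵇ ℂ} {f f' : Lp ℂ p μ}
    (h : f' =ᵐ[μ] fun x => g x * f x) : f' = boundedMul p μ g f :=
  Lp.ext (h.trans (boundedMul_ae_eq g f).symm)

theorem boundedMul_star (g : E →ᵇ ℂ) :
    boundedMul 2 μ (star g) = (boundedMul 2 μ g).adjoint := by
  refine (ContinuousLinearMap.eq_adjoint_iff _ _).mpr fun f h => ?_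
  rw [L2.inner_def, L2.inner_def]
  refine integral_congr_ae ?_
  filter_upwards [boundedMul_ae_eq (star g) f, boundedMul_ae_eq g h] with x h₁ h₂
  simp only [h₁, h₂, RCLike.inner_apply, BoundedContinuousFunction.star_apply, map_mul,
    RCLike.star_def, Complex.conj_conj]
  ring

variable (μ) in
/-- `boundedMul` as a representation of the star algebra of bounded continuous functions. -/
def boundedMulHom : (E →ᵇ ℂ) →⋆ₐ[ℂ] (Lp ℂ 2 μ →L[ℂ] Lp ℂ 2 μ) where
  toFun := boundedMul 2 μ
  map_one' := ContinuousLinearMap.ext fun f => (eq_boundedMul_apply (by simp)).symm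
  map_zero' := ContinuousLinearMap.ext fun f => (eq_boundedMul_apply (by
    filter_upwards [Lp.coeFn_zero ℂ 2 μ] with x h₁
    rw [zero_apply, h₁, BoundedContinuousFunction.coe_zero, Pi.zero_apply, zero_mul])).symm
  map_mul' g g' := ContinuousLinearMap.ext fun f => (eq_boundedMul_apply (by
    filter_upwards [boundedMul_ae_eq g (boundedMul 2 μ g' f), boundedMul_ae_eq g' f] with x h₁ h₂
    simp [h₁, h₂, mul_assoc])).symm
  map_add' g g' := ContinuousLinearMap.ext fun f => (eq_boundedMul_apply (by
    filter_upwards [Lp.coeFn_add (boundedMul 2 μ g f) (boundedMul 2 μ g' f),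
      boundedMul_ae_eq g f, boundedMul_ae_eq g' f] with x h₁ h₂ h₃
    rw [add_apply, h₁, Pi.add_apply, h₂, h₃, BoundedContinuousFunction.add_apply,
      add_mul])).symm
  commutes' c := ContinuousLinearMap.ext fun f => (eq_boundedMul_apply (by
    filter_upwards [Lp.coeFn_smul c f] with x h₁
    simp [h₁, Algebra.algebraMap_eq_smul_one])).symm
  map_star' := boundedMul_star

theorem inner_boundedMul (g : E →ᵇ ℂ) (f h : Lp ℂ 2 μ) :
    ⟪h, boundedMul 2 μ g f⟫_ℂ = ∫ x, g x * (f x * conj (h x)) ∂μ := by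
  rw [L2.inner_def]
  refine integral_congr_ae ?_
  filter_upwards [boundedMul_ae_eq g f] with x hx
  rw [hx, RCLike.inner_apply, mul_assoc]

theorem isStarNormal_boundedMul (g : E →ᵇ ℂ) : IsStarNormal (boundedMul 2 μ g) :=
  inferInstanceAs (IsStarNormal (boundedMulHom μ g))

/-- The bounded continuous functions whose multiplication operators commute with `T` and with
its adjoint. -/
def boundedCommutant (T : Lp ℂ 2 μ →L[ℂ] Lp ℂ 2 μ) : StarSubalgebra ℂ (E →ᵇ ℂ) :=
  (StarSubalgebra.centralizer ℂ {T}).comap (boundedMulHom μ)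

theorem mem_boundedCommutant_iff_commute {T : Lp ℂ 2 μ →L[ℂ] Lp ℂ 2 μ} {g : E →ᵇ ℂ} :
    g ∈ boundedCommutant T ↔ Commute T (boundedMul 2 μ g) := by
  have hmem : g ∈ boundedCommutant T ↔
      Commute T (boundedMul 2 μ g) ∧ Commute (star T) (boundedMul 2 μ g) := by
    simp only [boundedCommutant, StarSubalgebra.mem_comap, StarSubalgebra.mem_centralizer_iff,
      mem_singleton_iff, forall_eq]
    rfl
  rw [hmem, and_iff_left_iff_imp]
  intro h
  exact commute_star_comm.mpr ((isStarNormal_boundedMul g).commute_star_right h)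

end BoundedContinuous

end Multiplication

section Commutant

variable {E : Type*} [MeasurableSpace E] {μ : Measure E}

theorem integrable_mul_conj (f h : Lp ℂ 2 μ) : Integrable (fun x => f x * conj (h x)) μ := by
  simpa only [RCLike.inner_apply] using L2.integrable_inner (𝕜 := ℂ) h f

theorem integrable_boundedContinuous_mul [TopologicalSpace E] [OpensMeasurableSpace E]
    (g : E →ᵇ ℂ) {k : E → ℂ} (hk : Integrable k μ) : Integrable (fun x => g x * k x) μ :=
  hk.bdd_mul g.continuous.measurable.aestronglyMeasurable
    (Filter.Eventually.of_forall g.norm_coe_le_norm)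

variable [TopologicalSpace E] [PolishSpace E] [BorelSpace E]
  {S : StarSubalgebra ℂ (E →ᵇ ℂ)}

theorem ae_eq_zero_of_forall_integral_starSubalgebra_real
    (hS : (S.map (BoundedContinuousFunction.toContinuousMapStarₐ ℂ)).SeparatesPoints)
    {k : E → ℝ} (hk : Integrable k μ) (h0 : ∀ g ∈ S, ∫ x, g x * (k x : ℂ) ∂μ = 0) :
    k =ᵐ[μ] 0 := by
  have hm : AEMeasurable (fun x => ENNReal.ofReal (k x)) μ := hk.aemeasurable.ennreal_ofReal
  have hm' : AEMeasurable (fun x => ENNReal.ofReal (-k x)) μ := hk.aemeasurable.neg.ennreal_ofReal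
  have hfin : IsFiniteMeasure (μ.withDensity fun x => ENNReal.ofReal (k x)) :=
    isFiniteMeasure_withDensity_ofReal hk.2
  have hfin' : IsFiniteMeasure (μ.withDensity fun x => ENNReal.ofReal (-k x)) :=
    isFiniteMeasure_withDensity_ofReal hk.neg.2
  have hparts : (μ.withDensity fun x => ENNReal.ofReal (k x)) =
      μ.withDensity fun x => ENNReal.ofReal (-k x) := by
    refine ext_of_forall_mem_subalgebra_integral_eq_of_polish hS fun g hg => ?_
    rw [integral_withDensity_eq_integral_toReal_smul₀ hm (by simp),
      integral_withDensity_eq_integral_toReal_smul₀ hm' (by simp), ← sub_eq_zero, ← h0 g hg]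
    simp only [ENNReal.toReal_ofReal', Complex.real_smul, mul_comm _ (g _)]
    refine (integral_sub (integrable_boundedContinuous_mul g hk.pos_part.ofReal)
      (integrable_boundedContinuous_mul g hk.neg_part.ofReal)).symm.trans ?_
    simp only [← mul_sub, Complex.coe_algebraMap, ← Complex.ofReal_sub,
      max_zero_sub_max_neg_zero_eq_self]
  rw [withDensity_eq_iff hm hm' hk.lintegral_lt_top.ne] at hparts
  filter_upwards [hparts] with x (hx : ENNReal.ofReal (k x) = ENNReal.ofReal (-k x))
  rcases le_total (k x) 0 with h | h
  · rw [ENNReal.ofReal_of_nonpos h, eq_comm, ENNReal.ofReal_eq_zero] at hx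
    exact le_antisymm h (neg_nonpos.mp hx)
  · rw [ENNReal.ofReal_of_nonpos (neg_nonpos.mpr h), ENNReal.ofReal_eq_zero] at hx
    exact le_antisymm hx h

theorem ae_eq_zero_of_forall_integral_starSubalgebra
    (hS : (S.map (BoundedContinuousFunction.toContinuousMapStarₐ ℂ)).SeparatesPoints)
    {k : E → ℂ} (hk : Integrable k μ) (h0 : ∀ g ∈ S, ∫ x, g x * k x ∂μ = 0) :
    k =ᵐ[μ] 0 := by
  have hk' : Integrable (fun x => conj (k x)) μ :=
    Complex.conjCLE.toContinuousLinearMap.integrable_comp hk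
  have h0' : ∀ g ∈ S, ∫ x, g x * conj (k x) ∂μ = 0 := fun g hg => by
    simpa [← integral_conj] using congrArg conj (h0 (star g) (star_mem hg))
  have hre : (fun x => (k x).re) =ᵐ[μ] 0 := by
    refine ae_eq_zero_of_forall_integral_starSubalgebra_real hS hk.re fun g hg => ?_
    have hsplit : ∀ x, g x * ((k x).re : ℂ) = (1 / 2) * (g x * k x + g x * conj (k x)) := by
      intro x
      rw [Complex.re_eq_add_conj]
      ring
    simp only [hsplit]
    rw [integral_const_mul, integral_add (integrable_boundedContinuous_mul g hk)
      (integrable_boundedContinuous_mul g hk'), h0 g hg, h0' g hg, add_zero, mul_zero]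
  have him : (fun x => (k x).im) =ᵐ[μ] 0 := by
    refine ae_eq_zero_of_forall_integral_starSubalgebra_real hS hk.im fun g hg => ?_
    have hsplit : ∀ x, g x * ((k x).im : ℂ) =
        (1 / (2 * Complex.I)) * (g x * k x - g x * conj (k x)) := by
      intro x
      rw [Complex.im_eq_sub_conj]
      ring
    simp only [hsplit]
    rw [integral_const_mul, integral_sub (integrable_boundedContinuous_mul g hk)
      (integrable_boundedContinuous_mul g hk'), h0 g hg, h0' g hg, sub_zero, mul_zero]
  filter_upwards [hre, him] with x hx hx'
  exact Complex.ext hx hx'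

theorem mul_conj_ae_eq_mul_conj_adjoint {T : Lp ℂ 2 μ →L[ℂ] Lp ℂ 2 μ}
    (hS : ((boundedCommutant T).map
      (BoundedContinuousFunction.toContinuousMapStarₐ ℂ)).SeparatesPoints) (f h : Lp ℂ 2 μ) :
    (fun x => T f x * conj (h x)) =ᵐ[μ] fun x => f x * conj (T.adjoint h x) := by
  have hdiff := ae_eq_zero_of_forall_integral_starSubalgebra hS
    ((integrable_mul_conj (T f) h).sub (integrable_mul_conj f (T.adjoint h))) fun g hg => by
      simp only [Pi.sub_apply, mul_sub]
      rw [integral_sub (integrable_boundedContinuous_mul g (integrable_mul_conj _ _))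
        (integrable_boundedContinuous_mul g (integrable_mul_conj _ _)), ← inner_boundedMul,
        ← inner_boundedMul, T.adjoint_inner_left, sub_eq_zero]
      exact congrArg (⟪h, · f⟫_ℂ) (mem_boundedCommutant_iff_commute.mp hg).eq.symm
  filter_upwards [hdiff] with x hx
  exact sub_eq_zero.mp hx

end Commutant

section Symbol

variable {E : Type*} [MeasurableSpace E] {μ : Measure E} [SigmaFinite μ]

theorem ae_enorm_le_of_forall_ae_eq_mul (T : Lp ℂ 2 μ →L[ℂ] Lp ℂ 2 μ) {G : E → ℂ}
    (hG : Measurable G) (h : ∀ f : Lp ℂ 2 μ, T f =ᵐ[μ] fun x => G x * f x) :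
    ∀ᵐ x ∂μ, ‖G x‖ₑ ≤ ‖T‖ₑ := by
  suffices hsq : (fun x => ‖G x‖ₑ ^ 2) ≤ᵐ[μ] fun _ => ‖T‖ₑ ^ 2 by
    filter_upwards [hsq] with x hx
    exact (ENNReal.pow_le_pow_left_iff two_ne_zero).mp hx
  refine ae_le_of_forall_setLIntegral_le_of_sigmaFinite (by fun_prop) fun s hs hμs => ?_
  have hind : T (indicatorConstLp 2 hs hμs.ne (1 : ℂ)) =ᵐ[μ] s.indicator G := by
    filter_upwards [h (indicatorConstLp 2 hs hμs.ne (1 : ℂ)), indicatorConstLp_coeFn (p := 2)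
      (hs := hs) (hμs := hμs.ne) (c := (1 : ℂ))] with x hx hx'
    by_cases hxs : x ∈ s <;> simp [hx, hx', hxs]
  have hle := T.le_opENorm (indicatorConstLp 2 hs hμs.ne (1 : ℂ))
  rw [Lp.enorm_def, Lp.enorm_def, eLpNorm_congr_ae hind, eLpNorm_congr_ae indicatorConstLp_coeFn,
    eLpNorm_indicator_eq_eLpNorm_restrict hs, eLpNorm_two_eq,
    eLpNorm_indicator_const hs two_ne_zero ENNReal.ofNat_ne_top, enorm_one, one_mul] at hle
  have hle_sq := pow_le_pow_left₀ zero_le hle 2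
  rw [mul_pow, ← ENNReal.rpow_mul_natCast, ← ENNReal.rpow_mul_natCast] at hle_sq
  rw [setLIntegral_const]
  simpa using hle_sq

theorem exists_Lp_two_ae_ne_zero (μ : Measure E) [SigmaFinite μ] :
    ∃ w : Lp ℂ 2 μ, ∀ᵐ x ∂μ, w x ≠ 0 := by
  obtain ⟨v, hv_pos, hv_meas, hv_lt⟩ := exists_pos_lintegral_lt_of_sigmaFinite μ one_ne_zero
  have hmem : MemLp (fun x => ((√(v x : ℝ) : ℝ) : ℂ)) 2 μ := by
    refine ⟨by fun_prop, ?_⟩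
    have hsq : ∀ x, ‖((√(v x : ℝ) : ℝ) : ℂ)‖ₑ ^ 2 = v x := fun x => by
      rw [← ofReal_norm, Complex.norm_real, Real.norm_of_nonneg (Real.sqrt_nonneg _),
        ← ENNReal.ofReal_pow (Real.sqrt_nonneg _), Real.sq_sqrt (v x).coe_nonneg,
        ENNReal.ofReal_coe_nnreal]
    rw [eLpNorm_two_eq]
    simp only [hsq]
    exact ENNReal.rpow_lt_top_of_nonneg (by norm_num) (hv_lt.trans ENNReal.one_lt_top).ne
  refine ⟨hmem.toLp _, ?_⟩
  filter_upwards [hmem.coeFn_toLp] with x hx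
  rw [hx]
  exact_mod_cast (Real.sqrt_pos.mpr (hv_pos x)).ne'

variable [TopologicalSpace E] [PolishSpace E] [BorelSpace E]

theorem exists_eq_mulLp_of_separatesPoints {T : Lp ℂ 2 μ →L[ℂ] Lp ℂ 2 μ}
    (hS : ((boundedCommutant T).map
      (BoundedContinuousFunction.toContinuousMapStarₐ ℂ)).SeparatesPoints) :
    ∃ g : Lp ℂ ∞ μ, T = mulLp 2 g := by
  obtain ⟨w, hw⟩ := exists_Lp_two_ae_ne_zero μ
  set G : E → ℂ := fun x => conj (T.adjoint w x) / conj (w x) with hG_def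
  have hG : Measurable G :=
    (Complex.continuous_conj.measurable.comp (Lp.stronglyMeasurable _).measurable).div
      (Complex.continuous_conj.measurable.comp (Lp.stronglyMeasurable w).measurable)
  have hT : ∀ f : Lp ℂ 2 μ, T f =ᵐ[μ] fun x => G x * f x := fun f => by
    filter_upwards [mul_conj_ae_eq_mul_conj_adjoint hS f w, hw] with x hx hwx
    rw [hG_def, div_mul_eq_mul_div, eq_div_iff ((map_ne_zero _).mpr hwx), hx, mul_comm]
  have hmem : MemLp G ∞ μ := by
    refine memLp_top_of_bound hG.aestronglyMeasurable ‖T‖ ?_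
    filter_upwards [ae_enorm_le_of_forall_ae_eq_mul T hG hT] with x hx
    exact enorm_le_iff_norm_le.mp hx
  refine ⟨hmem.toLp G, ContinuousLinearMap.ext fun f => Lp.ext ?_⟩
  filter_upwards [hT f, hmem.coeFn_toLp, mulLp_ae_eq (hmem.toLp G) f] with x h₁ h₂ h₃
  rw [h₁, h₃, h₂]

theorem exists_eq_mulLp_of_commute_boundedMul {T : Lp ℂ 2 μ →L[ℂ] Lp ℂ 2 μ} {φ : E →ᵇ ℂ}
    (hφ : Function.Injective φ) (hT : Commute T (boundedMul 2 μ φ)) :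
    ∃ g : Lp ℂ ∞ μ, T = mulLp 2 g :=
  exists_eq_mulLp_of_separatesPoints fun _ _ hxy => ⟨φ, ⟨_,
    ⟨φ, mem_boundedCommutant_iff_commute.mpr hT, rfl⟩, rfl⟩, hφ.ne hxy⟩

end Symbol

section Fourier

open FourierTransform SchwartzMap

variable {V F : Type*} [NormedAddCommGroup V] [InnerProductSpace ℝ V] [FiniteDimensional ℝ V]
  [MeasurableSpace V] [BorelSpace V] [NormedAddCommGroup F] [InnerProductSpace ℂ F]
  [CompleteSpace F]

theorem fourier_Lp_two_ae_eq (h : Lp F 2 (volume : Measure V)) (hi : Integrable h) :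
    (𝓕 h : Lp F 2 (volume : Measure V)) =ᵐ[volume] 𝓕 (h : V → F) := by
  have hc : Continuous (𝓕 (h : V → F)) :=
    VectorFourier.fourierIntegral_continuous (μ := volume) (L := innerₗ V)
      (e := Real.fourierChar) Real.continuous_fourierChar continuous_inner hi
  refine ae_eq_of_integral_contDiff_smul_eq ((Lp.memLp _).locallyIntegrable one_le_two)
    hc.locallyIntegrable fun φ hφ hsupp => ?_
  have hsupp' : HasCompactSupport fun x => (φ x : ℂ) :=
    hsupp.comp_left (g := fun r : ℝ => (r : ℂ)) Complex.ofReal_zero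
  -- Both sides define the same tempered distribution, tested here against `ψ`.
  let ψ : 𝓢(V, ℂ) := hsupp'.toSchwartzMap (Complex.ofRealCLM.contDiff.comp hφ)
  have hψ : ∀ u : V → F, ∫ x, φ x • u x = ∫ x, ψ x • u x := fun u =>
    integral_congr_ae (Filter.Eventually.of_forall fun x => (Complex.coe_smul (φ x) (u x)).symm)
  have hdistr := congrArg (fun T => T ψ) (Lp.fourier_toTemperedDistribution_eq h)
  simp only [TemperedDistribution.fourier_apply, Lp.toTemperedDistribution_apply] at hdistr
  have hflip := VectorFourier.integral_fourierIntegral_smul_eq_flip (μ := volume) (ν := volume)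
    (L := innerₗ V) (e := Real.fourierChar) (f := (ψ : V → ℂ)) (g := (h : V → F))
    Real.continuous_fourierChar continuous_inner ψ.integrable hi
  rw [flip_innerₗ] at hflip
  rw [hψ, hψ, ← hdistr, SchwartzMap.fourier_coe]
  exact hflip

end Fourier

section Truncation

open Filter

variable {E F : Type*} [MeasurableSpace E] {μ : Measure E} [NormedAddCommGroup F] {p : ℝ≥0∞}

/-- The restriction of an `Lᵖ` function to a measurable set, extended by zero. -/
def indicatorLp {s : Set E} (hs : MeasurableSet s) (f : Lp F p μ) : Lp F p μ :=
  ((Lp.memLp f).indicator hs).toLp (s.indicator f)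

theorem indicatorLp_ae_eq {s : Set E} (hs : MeasurableSet s) (f : Lp F p μ) :
    indicatorLp hs f =ᵐ[μ] s.indicator f :=
  MemLp.coeFn_toLp _

theorem tendsto_indicatorLp [Fact (1 ≤ p)] (hp : p ≠ ∞) {ι : Type*} {l : Filter ι}
    [l.IsCountablyGenerated] {s : ι → Set E} (hs : ∀ i, MeasurableSet (s i)) (f : Lp F p μ)
    (hmem : ∀ᵐ x ∂μ, ∀ᶠ i in l, x ∈ s i) :
    Tendsto (fun i => indicatorLp (hs i) f) l (𝓝 f) := by
  have hp0 : p ≠ 0 := (zero_lt_one.trans_le Fact.out).ne'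
  have hp' : 0 < p.toReal := ENNReal.toReal_pos hp0 hp
  have hcompl : ∀ i, eLpNorm (⇑(indicatorLp (hs i) f) - ⇑f) p μ =
      (∫⁻ x, (s i)ᶜ.indicator (fun x => ‖f x‖ₑ ^ p.toReal) x ∂μ) ^ (1 / p.toReal) := by
    intro i
    rw [eLpNorm_eq_lintegral_rpow_enorm_toReal hp0 hp]
    congr 1
    refine lintegral_congr_ae ?_
    filter_upwards [indicatorLp_ae_eq (hs i) f] with x hx
    by_cases hxs : x ∈ s i <;> simp [hx, hxs, hp']
  have hfm : Measurable fun x => ‖f x‖ₑ ^ p.toReal :=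
    (Lp.stronglyMeasurable f).enorm.pow_const _
  have hlim : Tendsto (fun i => ∫⁻ x, (s i)ᶜ.indicator (fun x => ‖f x‖ₑ ^ p.toReal) x ∂μ) l
      (𝓝 (∫⁻ _, 0 ∂μ)) := by
    refine tendsto_lintegral_filter_of_dominated_convergence (fun x => ‖f x‖ₑ ^ p.toReal)
      (Eventually.of_forall fun i => hfm.indicator (hs i).compl) (Eventually.of_forall fun i =>
        Eventually.of_forall fun x => indicator_le_self _ _ x)
      (lintegral_rpow_enorm_lt_top_of_eLpNorm_lt_top hp0 hp (Lp.eLpNorm_lt_top f)).ne ?_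
    filter_upwards [hmem] with x hx
    refine tendsto_const_nhds.congr' ?_
    filter_upwards [hx] with i hi
    exact (indicator_of_notMem (notMem_compl_iff.mpr hi) _).symm
  rw [Lp.tendsto_Lp_iff_tendsto_eLpNorm']
  simp only [hcompl]
  simpa [ENNReal.zero_rpow_of_pos (inv_pos.mpr hp')] using hlim.ennrpow_const (1 / p.toReal)

theorem tendsto_eLpNorm_sub_iff [Fact (1 ≤ p)] {ι : Type*} {l : Filter ι} {u : ι → E → F}
    {u' : ι → Lp F p μ} (hu : ∀ᶠ i in l, u' i =ᵐ[μ] u i) (v : Lp F p μ) :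
    Tendsto (fun i => eLpNorm (fun x => u i x - v x) p μ) l (𝓝 0) ↔ Tendsto u' l (𝓝 v) := by
  rw [Lp.tendsto_Lp_iff_tendsto_eLpNorm']
  refine tendsto_congr' ?_
  filter_upwards [hu] with i hi
  exact eLpNorm_congr_ae (hi.symm.sub (EventuallyEq.refl _ _))

end Truncation

section MellinConvergence

variable {E : Type*} [NormedAddCommGroup E] [NormedSpace ℂ E] {f : ℝ → E} {s s' : ℂ}

theorem aestronglyMeasurable_of_mellinConvergent (hf : MellinConvergent f s) :
    AEStronglyMeasurable f (volume.restrict (Ioi 0)) := by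
  have hpow : ContinuousOn (fun t : ℝ => (t : ℂ) ^ (1 - s)) (Ioi 0) := fun t ht =>
    (Complex.continuousAt_ofReal_cpow_const t _ (Or.inr (ne_of_gt ht))).continuousWithinAt
  refine ((hpow.aestronglyMeasurable measurableSet_Ioi).smul hf.aestronglyMeasurable).congr ?_
  filter_upwards [ae_restrict_mem measurableSet_Ioi] with t ht
  have ht0 : (t : ℂ) ≠ 0 := Complex.ofReal_ne_zero.mpr (ne_of_gt ht)
  rw [Pi.smul_apply', smul_smul, ← Complex.cpow_add _ _ ht0, sub_add_sub_cancel, sub_self,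
    Complex.cpow_zero, one_smul]

theorem mellinConvergent_of_re_eq (hf : MellinConvergent f s) (h : s'.re = s.re) :
    MellinConvergent f s' := by
  have hmeas := aestronglyMeasurable_of_mellinConvergent hf
  rw [MellinConvergent, mellin_convergent_iff_norm subset_rfl measurableSet_Ioi hmeas] at hf ⊢
  rwa [h]

end MellinConvergence

section HardyMellinTransform

variable {f : ℝ → ℂ} {s : ℂ} {t : ℝ}

theorem integral_indicator_Ici_cpow (hs : s.re < 1) (ht : 0 < t) :
    ∫ x in Ioi 0, (Ici t).indicator (fun x : ℝ => (x : ℂ) ^ (s - 2)) x =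
      (t : ℂ) ^ (s - 1) / (1 - s) := by
  have hre : (s - 2).re < -1 := by
    rw [Complex.sub_re, Complex.re_ofNat]
    linarith
  rw [setIntegral_indicator measurableSet_Ici,
    inter_eq_self_of_subset_right (Ici_subset_Ioi.mpr ht), integral_Ici_eq_integral_Ioi,
    integral_Ioi_cpow_of_lt hre ht, ← neg_sub s 1, div_neg, neg_div]
  ring_nf

theorem integral_norm_indicator_Ici_cpow (hs : s.re < 1) (ht : 0 < t) :
    ∫ x in Ioi 0, ‖(Ici t).indicator (fun x : ℝ => (x : ℂ) ^ (s - 2)) x‖ =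
      t ^ (s.re - 1) / (1 - s.re) := by
  have hnorm : EqOn (fun x : ℝ => ‖(x : ℂ) ^ (s - 2)‖) (fun x => x ^ (s.re - 2)) (Ioi t) :=
    fun x hx => by simpa using Complex.norm_cpow_eq_rpow_re_of_pos (ht.trans hx) (s - 2)
  simp only [norm_indicator_eq_indicator_norm]
  rw [setIntegral_indicator measurableSet_Ici,
    inter_eq_self_of_subset_right (Ici_subset_Ioi.mpr ht), integral_Ici_eq_integral_Ioi,
    setIntegral_congr_fun measurableSet_Ioi hnorm, integral_Ioi_rpow_of_lt (by linarith) ht,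
    ← neg_sub s.re 1, div_neg, neg_div]
  ring_nf

theorem integrableOn_indicator_Ici_cpow (hs : s.re < 1) (ht : 0 < t) :
    IntegrableOn ((Ici t).indicator fun x : ℝ => (x : ℂ) ^ (s - 2)) (Ioi 0) := by
  have hre : (s - 2).re < -1 := by
    rw [Complex.sub_re, Complex.re_ofNat]
    linarith
  refine (IntegrableOn.integrable_indicator ?_ measurableSet_Ici).integrableOn
  exact (integrableOn_Ioi_cpow_of_lt hre ht).congr_set_ae Ioi_ae_eq_Ici.symm

theorem integrable_indicator_Ici_cpow_mul (hs : s.re < 1) (hf : MellinConvergent f s) :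
    Integrable (fun q : ℝ × ℝ =>
        (Ici q.1).indicator (fun x : ℝ => (x : ℂ) ^ (s - 2)) q.2 * f q.1)
      ((volume.restrict (Ioi 0)).prod (volume.restrict (Ioi 0))) := by
  have hpow : Measurable fun x : ℝ => (x : ℂ) ^ (s - 2) := by fun_prop
  have hkernel : Measurable fun q : ℝ × ℝ =>
      (Ici q.1).indicator (fun x : ℝ => (x : ℂ) ^ (s - 2)) q.2 :=
    (hpow.comp measurable_snd).indicator (measurableSet_le measurable_fst measurable_snd)
  refine (integrable_prod_iff (hkernel.aestronglyMeasurable.mul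
    (aestronglyMeasurable_of_mellinConvergent hf).comp_fst)).mpr ⟨?_, ?_⟩
  · filter_upwards [ae_restrict_mem measurableSet_Ioi] with t ht
    exact (integrableOn_indicator_Ici_cpow hs ht).mul_const (f t)
  · refine (hf.norm.div_const (1 - s.re)).congr ?_
    filter_upwards [ae_restrict_mem measurableSet_Ioi] with t ht
    simp only [Pi.mul_apply, norm_mul, norm_smul]
    rw [integral_mul_const, integral_norm_indicator_Ici_cpow hs ht,
      Complex.norm_cpow_eq_rpow_re_of_pos ht, Complex.sub_re, Complex.one_re, div_mul_eq_mul_div]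

theorem integral_indicator_Ici_cpow_mul {x : ℝ} (hx : 0 < x) (s : ℂ) (f : ℝ → ℂ) :
    ∫ t in Ioi 0, (Ici t).indicator (fun x : ℝ => (x : ℂ) ^ (s - 2)) x * f t =
      (x : ℂ) ^ (s - 1) • hardyFun f x := by
  have hx0 : (x : ℂ) ≠ 0 := Complex.ofReal_ne_zero.mpr hx.ne'
  have hswap : ∀ t, (Ici t).indicator (fun x : ℝ => (x : ℂ) ^ (s - 2)) x * f t =
      (Iic x).indicator (fun t => (x : ℂ) ^ (s - 2) * f t) t := fun t => by
    simp only [indicator, mem_Ici, mem_Iic, ite_mul, zero_mul]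
  have hpow : (x : ℂ) ^ (s - 1) * (1 / x) = (x : ℂ) ^ (s - 2) := by
    rw [mul_one_div, show s - 2 = s - 1 - 1 by ring, Complex.cpow_sub (s - 1) 1 hx0,
      Complex.cpow_one]
  simp only [hswap]
  rw [setIntegral_indicator measurableSet_Iic, Ioi_inter_Iic, integral_const_mul, hardyFun,
    smul_eq_mul, ← mul_assoc, hpow]

/-- Fubini for the homogeneous kernel `1_{t ≤ x} x ^ (s - 2) f t`. -/
theorem hasMellin_hardyFun (hs : s.re < 1) (hf : MellinConvergent f s) :
    HasMellin (hardyFun f) s (mellin f s / (1 - s)) := by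
  have hkernel := integrable_indicator_Ici_cpow_mul hs hf
  have hx : (fun x => ∫ t in Ioi 0, (Ici t).indicator (fun x : ℝ => (x : ℂ) ^ (s - 2)) x * f t)
      =ᵐ[volume.restrict (Ioi 0)] fun x => (x : ℂ) ^ (s - 1) • hardyFun f x := by
    filter_upwards [ae_restrict_mem measurableSet_Ioi] with x hx
    exact integral_indicator_Ici_cpow_mul hx s f
  refine ⟨hkernel.integral_prod_right.congr hx, ?_⟩
  rw [mellin, ← integral_congr_ae hx, ← integral_integral_swap hkernel, mellin,
    ← integral_div]
  refine setIntegral_congr_fun measurableSet_Ioi fun t ht => ?_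
  simp only [integral_mul_const, integral_indicator_Ici_cpow hs ht, smul_eq_mul]
  ring

end HardyMellinTransform

section MellinPlancherel

open Filter

theorem sqrt_two_pi_ne_zero : (√(2 * Real.pi) : ℂ) ≠ 0 :=
  Complex.ofReal_ne_zero.mpr (Real.sqrt_pos.mpr Real.two_pi_pos).ne'

theorem cpow_half_add_mul_I_sub_one (t y : ℝ) :
    (t : ℂ) ^ (1 / 2 + Complex.I * y - 1 : ℂ) = (t : ℂ) ^ (Complex.I * y - 1 / 2 : ℂ) := by
  congr 1
  ring

theorem mellinQ_ae_eq_mellin {f : L2Pos} (hf : MellinConvergent f (1 / 2)) :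
    mellinQ f =ᵐ[volume] fun y => (√(2 * Real.pi) : ℂ)⁻¹ * mellin f (1 / 2 + Complex.I * y) := by
  have hint : IntegrableOn (fun t : ℝ => f t * (t : ℂ) ^ (-(1 / 2) : ℂ)) (Ioi 0) :=
    IntegrableOn.congr_fun hf (fun t _ => by rw [smul_eq_mul, mul_comm]; norm_num) measurableSet_Ioi
  filter_upwards [mellinQ_ae_eq f hint] with y hy
  rw [hy, one_div (√(2 * Real.pi) : ℂ)]
  simp only [mellin, cpow_half_add_mul_I_sub_one, smul_eq_mul, mul_comm]

theorem mellinConvergent_indicatorLp_Icc (f : L2Pos) {R : ℝ} (hR : 0 < R) (s : ℂ) :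
    MellinConvergent (indicatorLp (measurableSet_Icc (a := R⁻¹) (b := R)) f) s := by
  have hpos : ∀ t ∈ Icc R⁻¹ R, 0 < t := fun t ht => (inv_pos.mpr hR).trans_le ht.1
  have hfL2 : MemLp f 2 (volume.restrict (Icc R⁻¹ R)) :=
    (Lp.memLp f).mono_measure (Measure.restrict_mono hpos le_rfl)
  have hpow : ContinuousOn (fun t : ℝ => (t : ℂ) ^ (s - 1)) (Icc R⁻¹ R) := fun t ht =>
    (Complex.continuousAt_ofReal_cpow_const t _ (Or.inr (hpos t ht).ne')).continuousWithinAt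
  have hint : IntegrableOn (fun t : ℝ => (t : ℂ) ^ (s - 1) * f t) (Icc R⁻¹ R) :=
    IntegrableOn.continuousOn_mul hpow (hfL2.integrable one_le_two) isCompact_Icc
  refine (hint.integrable_indicator measurableSet_Icc).integrableOn.congr ?_
  filter_upwards [indicatorLp_ae_eq (measurableSet_Icc (a := R⁻¹) (b := R)) f] with t ht
  rw [ht, smul_eq_mul, indicator_mul_right]

theorem mellin_indicatorLp_Icc (f : L2Pos) {R : ℝ} (hR : 0 < R) (y : ℝ) :
    mellin (indicatorLp (measurableSet_Icc (a := R⁻¹) (b := R)) f) (1 / 2 + Complex.I * y) =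
      innerTrunc f R y := by
  have hsub : Icc R⁻¹ R ⊆ Ioi 0 := fun t ht => (inv_pos.mpr hR).trans_le ht.1
  conv_rhs => rw [innerTrunc, ← inter_eq_self_of_subset_right hsub,
    ← setIntegral_indicator measurableSet_Icc]
  refine integral_congr_ae ?_
  filter_upwards [indicatorLp_ae_eq (measurableSet_Icc (a := R⁻¹) (b := R)) f] with t ht
  rw [ht, cpow_half_add_mul_I_sub_one, smul_eq_mul, indicator_mul_left, mul_comm]

theorem tendsto_indicatorLp_Icc_inv (f : L2Pos) :
    Tendsto (fun R : ℝ => indicatorLp (measurableSet_Icc (a := R⁻¹) (b := R)) f) atTop (𝓝 f) := by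
  refine tendsto_indicatorLp ENNReal.ofNat_ne_top (s := fun R : ℝ => Icc R⁻¹ R) _ f ?_
  filter_upwards [ae_restrict_mem measurableSet_Ioi] with t ht
  filter_upwards [eventually_ge_atTop t, tendsto_inv_atTop_zero.eventually_le_const ht]
    with R hR hR'
  exact ⟨hR', hR⟩

theorem tendsto_indicatorLp_Icc_neg (F : L2Line) :
    Tendsto (fun R : ℝ => indicatorLp (measurableSet_Icc (a := -R) (b := R)) F) atTop (𝓝 F) := by
  refine tendsto_indicatorLp ENNReal.ofNat_ne_top (s := fun R : ℝ => Icc (-R) R) _ F ?_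
  refine Eventually.of_forall fun y => ?_
  filter_upwards [eventually_ge_atTop |y|] with R hR
  exact abs_le.mp hR

theorem tendsto_innerTrunc_iff (f : L2Pos) (F : L2Line) :
    Tendsto (fun R : ℝ => eLpNorm (fun y => innerTrunc f R y - F y) 2 volume) atTop (𝓝 0) ↔
      F = (√(2 * Real.pi) : ℂ) • mellinQ f := by
  have hlim := ((mellinQ.continuous.tendsto f).comp
    (tendsto_indicatorLp_Icc_inv f)).const_smul (√(2 * Real.pi) : ℂ)
  rw [tendsto_eLpNorm_sub_iff (u' := fun R : ℝ => (√(2 * Real.pi) : ℂ) •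
    mellinQ (indicatorLp (measurableSet_Icc (a := R⁻¹) (b := R)) f)) ?_ F]
  · exact ⟨fun h => tendsto_nhds_unique h hlim, fun h => h ▸ hlim⟩
  filter_upwards [eventually_gt_atTop 0] with R hR
  filter_upwards [mellinQ_ae_eq_mellin (mellinConvergent_indicatorLp_Icc f hR _),
    Lp.coeFn_smul (√(2 * Real.pi) : ℂ) (mellinQ (indicatorLp measurableSet_Icc f))] with y hy hy'
  rw [hy', Pi.smul_apply, hy, smul_eq_mul, mul_inv_cancel_left₀ sqrt_two_pi_ne_zero,
    mellin_indicatorLp_Icc f hR]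

theorem exp_two_pi_cpow (x : ℝ) (s : ℂ) :
    ((Real.exp (2 * Real.pi * x) : ℝ) : ℂ) ^ s = Complex.exp (2 * Real.pi * x * s) := by
  rw [Complex.ofReal_exp, Complex.cpow_def_of_ne_zero (Complex.exp_ne_zero _),
    ← Complex.ofReal_exp, ← Complex.ofReal_log (Real.exp_pos _).le, Real.log_exp]
  push_cast
  rfl

open scoped FourierTransform in
theorem logPull_outerTrunc {G H : ℝ → ℂ} {R : ℝ} (hH : H =ᵐ[volume] (Icc (-R) R).indicator G)
    (x : ℝ) : logPull (outerTrunc G R) x = (√(2 * Real.pi) : ℂ)⁻¹ * 𝓕 H x := by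
  have hsq : (√(2 * Real.pi) : ℂ) * √(2 * Real.pi) = 2 * Real.pi := by
    exact_mod_cast Real.mul_self_sqrt Real.two_pi_pos.le
  have hexp : ∀ y : ℝ, ((Real.exp (2 * Real.pi * x) : ℝ) : ℂ) ^ (-(Complex.I * y) - 1 / 2) * G y =
      Complex.exp (-(Real.pi * x)) *
        (Complex.exp (((-2 * Real.pi * y * x : ℝ) : ℂ) * Complex.I) * G y) := fun y => by
    rw [exp_two_pi_cpow, ← mul_assoc, ← Complex.exp_add]
    congr 2
    push_cast
    ring
  have hfourier : 𝓕 H x = ∫ y in Icc (-R) R,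
      Complex.exp (((-2 * Real.pi * y * x : ℝ) : ℂ) * Complex.I) * G y := by
    rw [Real.fourier_real_eq_integral_exp_smul, ← integral_indicator measurableSet_Icc]
    refine integral_congr_ae ?_
    filter_upwards [hH] with y hy
    rw [hy, smul_eq_mul, indicator_mul_right]
  simp only [logPull, outerTrunc, hexp, integral_const_mul]
  rw [← hfourier, Complex.exp_neg]
  have hs0 := sqrt_two_pi_ne_zero
  have hx0 := Complex.exp_ne_zero (Real.pi * x)
  push_cast
  rw [← hsq]
  field_simp

theorem integrable_indicatorLp_Icc (F : L2Line) (a b : ℝ) :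
    Integrable (indicatorLp (measurableSet_Icc (a := a) (b := b)) F) := by
  have hF : IntegrableOn F (Icc a b) := ((Lp.memLp F).restrict _).integrable one_le_two
  exact (hF.integrable_indicator measurableSet_Icc).congr (indicatorLp_ae_eq _ F).symm

theorem eLpNorm_sub_eq_eLpNorm_logPull_sub (u : ℝ → ℂ) (h : L2Pos) :
    eLpNorm (fun t => u t - h t) 2 (volume.restrict (Ioi 0)) =
      eLpNorm (fun x => logPull u x - logPullEquiv h x) 2 volume := by
  rw [← eLpNorm_logPull]
  refine eLpNorm_congr_ae ?_
  filter_upwards [(logPull_memLp h).coeFn_toLp] with x hx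
  rw [show logPullEquiv h x = logPull h x from hx]
  simp only [logPull, mul_sub]

theorem tendsto_outerTrunc_iff {G : ℝ → ℂ} {K : L2Line} (hK : K =ᵐ[volume] G) (h : L2Pos) :
    Tendsto (fun R : ℝ => eLpNorm (fun t => outerTrunc G R t - h t) 2
      (volume.restrict (Ioi 0))) atTop (𝓝 0) ↔ mellinQ h = (√(2 * Real.pi) : ℂ)⁻¹ • K := by
  have hlim := (((Lp.fourierTransformₗᵢ ℝ ℂ).continuous.tendsto K).comp
    (tendsto_indicatorLp_Icc_neg K)).const_smul (√(2 * Real.pi) : ℂ)⁻¹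
  have hiff : mellinQ h = (√(2 * Real.pi) : ℂ)⁻¹ • K ↔
      logPullEquiv h = (√(2 * Real.pi) : ℂ)⁻¹ • Lp.fourierTransformₗᵢ ℝ ℂ K := by
    rw [mellinQ, LinearIsometryEquiv.trans_apply, LinearIsometryEquiv.symm_apply_eq, map_smul]
  simp only [eLpNorm_sub_eq_eLpNorm_logPull_sub]
  rw [hiff, tendsto_eLpNorm_sub_iff (u' := fun R : ℝ => (√(2 * Real.pi) : ℂ)⁻¹ •
    Lp.fourierTransformₗᵢ ℝ ℂ (indicatorLp (measurableSet_Icc (a := -R) (b := R)) K)) ?_ _]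
  · exact ⟨fun h => tendsto_nhds_unique h hlim, fun h => h ▸ hlim⟩
  refine Eventually.of_forall fun R => ?_
  have hind : indicatorLp (measurableSet_Icc (a := -R) (b := R)) K =ᵐ[volume]
      (Icc (-R) R).indicator G := (indicatorLp_ae_eq _ K).trans (Filter.EventuallyEq.indicator hK)
  filter_upwards [fourier_Lp_two_ae_eq _ (integrable_indicatorLp_Icc K (-R) R),
    Lp.coeFn_smul (√(2 * Real.pi) : ℂ)⁻¹
      (Lp.fourierTransformₗᵢ ℝ ℂ (indicatorLp measurableSet_Icc K))] with x hx hx'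
  rw [hx', Pi.smul_apply, logPull_outerTrunc hind, ← hx, smul_eq_mul]
  rfl

theorem isMellinDoubleIntegral_iff (g : Lp ℂ ∞ (volume : Measure ℝ)) (f h : L2Pos) :
    IsMellinDoubleIntegral g f h ↔ h = mellinMultiplier g f := by
  have hmul : ∀ F : L2Line, mulOp g F =ᵐ[volume] fun y => g y * F y := mulLp_ae_eq g
  simp only [IsMellinDoubleIntegral, tendsto_innerTrunc_iff, exists_eq_left,
    tendsto_outerTrunc_iff (hmul _)]
  rw [map_smul, inv_smul_smul₀ sqrt_two_pi_ne_zero]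
  exact mellinQ.eq_symm_apply.symm

end MellinPlancherel

section Diagonalization

open Filter

theorem half_sub_I_mul_ne_zero (y : ℝ) : (1 / 2 - Complex.I * y : ℂ) ≠ 0 := fun h => by
  simpa using congrArg Complex.re h

theorem norm_half_sub_I_mul_inv_le (y : ℝ) : ‖(1 / 2 - Complex.I * y : ℂ)⁻¹‖ ≤ 2 := by
  have hre : (1 / 2 - Complex.I * y : ℂ).re = 1 / 2 := by simp
  rw [norm_inv]
  refine inv_le_of_inv_le₀ two_pos ?_
  rw [← one_div, ← hre]
  exact Complex.re_le_norm _

/-- The symbol of the Hardy operator under the Mellin transform. -/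
def hardySymbol : ℝ →ᵇ ℂ :=
  BoundedContinuousFunction.ofNormedAddCommGroup (fun y : ℝ => (1 / 2 - Complex.I * y : ℂ)⁻¹)
    (Continuous.inv₀ (by fun_prop) half_sub_I_mul_ne_zero) 2 norm_half_sub_I_mul_inv_le

theorem hardySymbol_apply (y : ℝ) : hardySymbol y = (1 / 2 - Complex.I * y : ℂ)⁻¹ := rfl

theorem hardySymbol_injective : Function.Injective hardySymbol := fun y z h => by
  simpa [hardySymbol_apply] using h

theorem hasMellin_hardyInfty {f : L2Pos} {s : ℂ} (hs : s.re < 1) (hf : MellinConvergent f s) :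
    HasMellin (hardyInfty f) s (mellin f s / (1 - s)) := by
  obtain ⟨hconv, hmellin⟩ := hasMellin_hardyFun hs hf
  have hae : (fun t : ℝ => (t : ℂ) ^ (s - 1) • hardyInfty f t)
      =ᵐ[volume.restrict (Ioi 0)] fun t => (t : ℂ) ^ (s - 1) • hardyFun f t :=
    (EventuallyEq.refl _ _).smul (hardyFun_memLp f).coeFn_toLp
  exact ⟨Integrable.congr hconv hae.symm, (integral_congr_ae hae).trans hmellin⟩

theorem mellinQ_hardyInfty_of_mellinConvergent {f : L2Pos} (hf : MellinConvergent f (1 / 2)) :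
    mellinQ (hardyInfty f) = boundedMul 2 volume hardySymbol (mellinQ f) := by
  have hre : ∀ y : ℝ, (1 / 2 + Complex.I * y : ℂ).re = 1 / 2 := fun y => by simp
  have hline : ∀ y : ℝ, HasMellin (hardyInfty f) (1 / 2 + Complex.I * y)
      (mellin f (1 / 2 + Complex.I * y) / (1 - (1 / 2 + Complex.I * y))) := fun y =>
    hasMellin_hardyInfty (by rw [hre]; norm_num)
      (mellinConvergent_of_re_eq hf (by rw [hre]; norm_num))
  have hconv : MellinConvergent (hardyInfty f) (1 / 2) := by simpa using (hline 0).1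
  refine eq_boundedMul_apply ?_
  filter_upwards [mellinQ_ae_eq_mellin hf, mellinQ_ae_eq_mellin hconv] with y hy hy'
  rw [hy', (hline y).2, hy, hardySymbol_apply, ← sub_sub, sub_half]
  ring

theorem mellinQ_hardyInfty (f : L2Pos) :
    mellinQ (hardyInfty f) = boundedMul 2 volume hardySymbol (mellinQ f) := by
  have hlim := tendsto_indicatorLp_Icc_inv f
  refine tendsto_nhds_unique
    (((mellinQ.continuous.comp hardyInfty.continuous).tendsto f).comp hlim)
    ((((boundedMul 2 volume hardySymbol).continuous.comp mellinQ.continuous).tendsto f).comp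
      hlim |>.congr' ?_)
  filter_upwards [eventually_gt_atTop 0] with R hR
  exact (mellinQ_hardyInfty_of_mellinConvergent (mellinConvergent_indicatorLp_Icc f hR _)).symm

end Diagonalization

section HardyCommutant

theorem mellinQ_mellinMultiplier (g : Lp ℂ ∞ (volume : Measure ℝ)) (f : L2Pos) :
    mellinQ (mellinMultiplier g f) = mulLp 2 g (mellinQ f) :=
  mellinQ.apply_symm_apply _

theorem commute_mellinMultiplier_hardyInfty (g : Lp ℂ ∞ (volume : Measure ℝ)) :
    Commute (mellinMultiplier g) hardyInfty := by
  refine ContinuousLinearMap.ext fun f => mellinQ.injective ?_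
  have hcomm := DFunLike.congr_fun
    (commute_mulLp (p := 2) g (hardySymbol.memLp_top.toLp hardySymbol)).eq (mellinQ f)
  simpa only [ContinuousLinearMap.mul_def, ContinuousLinearMap.comp_apply,
    mellinQ_mellinMultiplier, mellinQ_hardyInfty, boundedMul] using hcomm

/-- The operator `Q A Q⁻¹` on `L²(iℝ)`. -/
def mellinConj (A : L2Pos →L[ℂ] L2Pos) : L2Line →L[ℂ] L2Line :=
  (mellinQ : L2Pos →L[ℂ] L2Line) ∘L A ∘L (mellinQ.symm : L2Line →L[ℂ] L2Pos)

theorem mellinConj_mellinQ (A : L2Pos →L[ℂ] L2Pos) (f : L2Pos) :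
    mellinConj A (mellinQ f) = mellinQ (A f) :=
  congrArg (fun u => mellinQ (A u)) (mellinQ.symm_apply_apply f)

theorem commute_mellinConj_boundedMul {A : L2Pos →L[ℂ] L2Pos} (hA : Commute A hardyInfty) :
    Commute (mellinConj A) (boundedMul 2 volume hardySymbol) := by
  refine ContinuousLinearMap.ext fun F => ?_
  obtain ⟨f, rfl⟩ := mellinQ.surjective F
  have hf : A (hardyInfty f) = hardyInfty (A f) := DFunLike.congr_fun hA.eq f
  simp only [ContinuousLinearMap.mul_def, ContinuousLinearMap.comp_apply, mellinConj_mellinQ,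
    ← mellinQ_hardyInfty, hf]

theorem exists_eq_mellinMultiplier {A : L2Pos →L[ℂ] L2Pos} (hA : Commute A hardyInfty) :
    ∃ g : Lp ℂ ∞ (volume : Measure ℝ), A = mellinMultiplier g := by
  obtain ⟨g, hg⟩ := exists_eq_mulLp_of_commute_boundedMul hardySymbol_injective
    (commute_mellinConj_boundedMul hA)
  refine ⟨g, ContinuousLinearMap.ext fun f => mellinQ.injective ?_⟩
  rw [mellinQ_mellinMultiplier, ← hg, mellinConj_mellinQ]

end HardyCommutant

end

end HardyMellin

theorem mainTheorem7 (A : L2Pos →L[ℂ] L2Pos) :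
    (Commute A hardyInfty ↔
      ∃ g : Lp ℂ ∞ (volume : Measure ℝ), ∀ f : L2Pos, IsMellinDoubleIntegral g f (A f)) ∧
    (Commute A hardyInfty ↔
      ∃ g : Lp ℂ ∞ (volume : Measure ℝ), A = mellinMultiplier g) ∧
    ∀ g : Lp ℂ ∞ (volume : Measure ℝ),
      (∀ f : L2Pos, IsMellinDoubleIntegral g f (A f)) ↔ A = mellinMultiplier g := by
  have formula_iff : ∀ g : Lp ℂ ∞ (volume : Measure ℝ),
      (∀ f : L2Pos, IsMellinDoubleIntegral g f (A f)) ↔ A = mellinMultiplier g := fun g => by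
    simp only [isMellinDoubleIntegral_iff, ContinuousLinearMap.ext_iff]
  have commute_iff : Commute A hardyInfty ↔
      ∃ g : Lp ℂ ∞ (volume : Measure ℝ), A = mellinMultiplier g :=
    ⟨exists_eq_mellinMultiplier, fun ⟨g, hg⟩ => hg ▸ commute_mellinMultiplier_hardyInfty g⟩
  exact ⟨by simpa only [formula_iff] using commute_iff, commute_iff, formula_iff⟩
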